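/- **Theorem 1.1.** Let $X$ be a complex (respectively, real) Banach space with dual $X'$, let $d\in\mathbb{N}$, let $\Omega\subset\mathbb{C}$ (respectively, $\Omega\subset\mathbb{R}^d$) be open, and let $f:\Omega\to X$ be an arbitrary function. Call a function $u$ from $\Omega$ to a Banach space *holomorphic* if it is complex differentiable at every point of $\Omega$, and *harmonic* if it is twice continuously differentiable on $\Omega$ with $\Delta u=0$ on $\Omega$. Then $f$ is holomorphic (respectively, harmonic) if and only if both of the following conditions hold: 1. $f$ is locally $L^1$-bounded: there is a function $g\in L^1_{\mathrm{loc}}(\Omega,\mathbb{R})$ such that $\|f(\xi)\|_X\le g(\xi)$ for almost every $\xi\in\Omega$; 2. $f$ is very weakly holomorphic (respectively, very weakly harmonic): there is a set $W\subset X'$ that separates the points of $X$ such that $x'\circ f$ is holomorphic (respectively, harmonic) on $\Omega$ for every $x'\in W$. -/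

import Mathlib

open MeasureTheory

/-- A set `W ⊆ X'` of continuous linear functionals is separating if any two distinct points
of `X` are distinguished by some member of `W`. -/
def IsSeparating {𝕜 X : Type*} [RCLike 𝕜] [NormedAddCommGroup X] [NormedSpace 𝕜 X]
    (W : Set (StrongDual 𝕜 X)) : Prop :=
  ∀ x y : X, x ≠ y → ∃ φ ∈ W, φ x ≠ φ y

/-- `f` is locally `L¹`-bounded on `Ω`: its norm is dominated, almost everywhere on `Ω`, by a
function in `L¹_loc(Ω, ℝ)`. No measurability of `f` is required. -/
def IsLocallyL1Bounded {E X : Type*} [TopologicalSpace E] [MeasureSpace E]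
    [NormedAddCommGroup X] (Ω : Set E) (f : E → X) : Prop :=
  ∃ g : E → ℝ, LocallyIntegrableOn g Ω volume ∧
    ∀ᵐ ξ ∂(volume.restrict Ω), ‖f ξ‖ ≤ g ξ

/-- `f` is very weakly holomorphic on the open set `Ω ⊆ ℂ`. -/
def IsVeryWeaklyHolomorphic {X : Type*} [NormedAddCommGroup X] [NormedSpace ℂ X]
    (Ω : Set ℂ) (f : ℂ → X) : Prop :=
  ∃ W : Set (StrongDual ℂ X), IsSeparating W ∧
    ∀ φ ∈ W, DifferentiableOn ℂ (fun z => φ (f z)) Ω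

/-- `f` is very weakly harmonic on the open set `Ω ⊆ ℝᵈ`. -/
def IsVeryWeaklyHarmonic {X : Type*} [NormedAddCommGroup X] [NormedSpace ℝ X] {d : ℕ}
    (Ω : Set (EuclideanSpace ℝ (Fin d))) (f : EuclideanSpace ℝ (Fin d) → X) : Prop :=
  ∃ W : Set (StrongDual ℝ X), IsSeparating W ∧
    ∀ φ ∈ W, InnerProductSpace.HarmonicOnNhd (fun ξ => φ (f ξ)) Ω

/-!
Let `V` be the space of all functionals `φ` for which `φ ∘ f` is holomorphic (harmonic); it
separates the points of `X`. Write `J : X → V'` for the evaluation map, `J x φ = φ x`.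

* *The map `J ∘ f` is holomorphic (harmonic) into `V'`.* A harmonic function is locally reproduced
  by convolution with a fixed smooth compactly supported kernel (`exists_reproducing_kernel`), so
  a harmonic function dominated almost everywhere by `c * g` has a local Lipschitz constant that is
  `c` times a constant depending only on `g` (`exists_norm_sub_le_of_ae_norm_le`). Since
  `‖φ ∘ f‖ ≤ ‖φ‖ * g`, the map `J ∘ f` is continuous for the norm of `V'`
  (`continuousOn_flip_comp`). A continuous function that becomes holomorphic (harmonic) under a
  separating family of functionals, here the evaluations at the elements of `V`, is itself
  holomorphic (harmonic): it satisfies Cauchy's formula (the reproducing formula)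
  (`differentiableOn_of_continuousOn_of_forall_dual`,
  `harmonicOnNhd_of_continuousOn_of_forall_dual`).
* *The map `J` is bounded below.* For every `Λ` in the bidual `V''` the function `Λ ∘ J ∘ f` is
  holomorphic (harmonic), so `Λ ∘ J` belongs to `V`. Thus the transpose of `J` maps `V''` onto `V`.
  A Hahn-Banach argument in the style of the closed range theorem then gives
  `‖x‖ ≤ 2 * ‖J x‖` (`norm_le_two_mul_norm_flip`). This takes the place of the
  Krein-Šmulian theorem.

Hence `f` is continuous for the norm of `X`, and the regularity criterion for continuous functions,
applied to `f` itself, finishes the proof.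

In the lemmas, `V` is an abstract normed space with a linear isometry `ι` into the dual of `X`, and
`J` is `ι.toContinuousLinearMap.flip`.
-/

/-! ### Spaces of functionals that contain the image of their bidual -/

/-- If the transpose of `J : X → V'` takes its values in `V`, then `J x` is a limit of images
of vectors of norm at most `‖J x‖`. A functional `Λ` strictly separating `J x` from these images
would pull back to some `φ ∈ V` with `‖J x‖ * ‖φ‖ < re (φ x)`, whereas
`|φ x| = |J x φ| ≤ ‖J x‖ * ‖φ‖`. -/
theorem mem_closure_image_closedBall {𝕜 X : Type*} [RCLike 𝕜] [NormedAddCommGroup X]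
    [NormedSpace 𝕜 X] {V : Type*} [NormedAddCommGroup V] [NormedSpace 𝕜 V]
    (ι : V →ₗᵢ[𝕜] StrongDual 𝕜 X)
    (hι : ∀ Λ : StrongDual 𝕜 (StrongDual 𝕜 V),
      Λ.comp ι.toContinuousLinearMap.flip ∈ Set.range ι) (x : X) :
    ι.toContinuousLinearMap.flip x ∈
      closure (ι.toContinuousLinearMap.flip ''
        Metric.closedBall 0 ‖ι.toContinuousLinearMap.flip x‖) := by
  let _ : NormedSpace ℝ X := NormedSpace.restrictScalars ℝ 𝕜 X
  set J := ι.toContinuousLinearMap.flip with hJ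
  by_contra hx
  have hconv : Convex ℝ (closure (J '' Metric.closedBall 0 ‖J x‖)) :=
    ((convex_closedBall (0 : X) ‖J x‖).is_linear_image
      (J.toLinearMap.restrictScalars ℝ).isLinear).closure
  obtain ⟨Λ, u, hΛ, hu⟩ :=
    RCLike.geometric_hahn_banach_closed_point (𝕜 := 𝕜) hconv isClosed_closure hx
  replace hΛ : ∀ b : X, ‖b‖ ≤ ‖J x‖ → RCLike.re (Λ (J b)) < u := fun b hb =>
    hΛ _ (subset_closure ⟨b, by simpa using hb, rfl⟩)
  set φ : StrongDual 𝕜 X := Λ.comp J with hφ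
  obtain ⟨v, hv⟩ : φ ∈ Set.range ι := hι Λ
  have hu0 : 0 < u := by simpa using hΛ 0 (by simp)
  have hφx : ‖φ x‖ ≤ ‖J x‖ * ‖φ‖ := by
    rw [← hv, ι.norm_map]
    exact (J x).le_opNorm v
  have hnorm : ‖J x‖ * ‖φ‖ ≤ u := by
    rcases (norm_nonneg (J x)).eq_or_lt with h0 | h0
    · rw [← h0, zero_mul]; exact hu0.le
    rw [mul_comm, ← le_div_iff₀ h0]
    refine φ.opNorm_le_bound (by positivity) fun y => ?_
    by_cases hy : φ y = 0
    · rw [hy, norm_zero]; positivity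
    have hy0 : y ≠ 0 := by rintro rfl; simp at hy
    have hy1 : 0 < ‖y‖ := norm_pos_iff.2 hy0
    have hy2 : 0 < ‖φ y‖ := norm_pos_iff.2 hy
    -- the multiple of `y` of norm `‖J x‖` at which `φ` is real and positive
    have := hΛ ((((‖J x‖ / (‖y‖ * ‖φ y‖) : ℝ) : 𝕜) * starRingEnd 𝕜 (φ y)) • y) (by
      rw [norm_smul, norm_mul, RCLike.norm_conj, RCLike.norm_ofReal, abs_of_pos (by positivity)]
      apply le_of_eq; field_simp)
    have h2 : RCLike.re (Λ (J ((((‖J x‖ / (‖y‖ * ‖φ y‖) : ℝ) : 𝕜) *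
        starRingEnd 𝕜 (φ y)) • y))) = ‖J x‖ / ‖y‖ * ‖φ y‖ := by
      rw [map_smul, map_smul, smul_eq_mul, mul_assoc]
      change RCLike.re (_ * (_ * φ y)) = _
      rw [RCLike.conj_mul, ← RCLike.ofReal_pow, ← RCLike.ofReal_mul, RCLike.ofReal_re]
      field_simp
    rw [h2] at this
    rw [div_mul_eq_mul_div, le_div_iff₀ h0]
    rw [div_mul_eq_mul_div, div_lt_iff₀ hy1] at this
    linarith
  have h3 : RCLike.re (φ x) ≤ ‖φ x‖ := RCLike.re_le_norm _
  have h4 : u < RCLike.re (φ x) := hu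
  linarith

/-- If `V` separates the points of the Banach space `X` and the transpose of `J : X → V'` takes
its values in `V`, then `J` is bounded below. As in the open mapping theorem, the approximate
solutions given by `mem_closure_image_closedBall` are improved by successive approximation. -/
theorem norm_le_two_mul_norm_flip {𝕜 X : Type*} [RCLike 𝕜] [NormedAddCommGroup X]
    [NormedSpace 𝕜 X] [CompleteSpace X] {V : Type*} [NormedAddCommGroup V] [NormedSpace 𝕜 V]
    (ι : V →ₗᵢ[𝕜] StrongDual 𝕜 X) (hsep : ∀ x : X, (∀ v, ι v x = 0) → x = 0)
    (hι : ∀ Λ : StrongDual 𝕜 (StrongDual 𝕜 V),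
      Λ.comp ι.toContinuousLinearMap.flip ∈ Set.range ι) (x : X) :
    ‖x‖ ≤ 2 * ‖ι.toContinuousLinearMap.flip x‖ := by
  set J := ι.toContinuousLinearMap.flip with hJ
  have hstep : ∀ y : X, ∃ y' : X, ‖y - y'‖ ≤ ‖J y‖ ∧ ‖J y'‖ ≤ ‖J y‖ / 2 := by
    intro y
    rcases (norm_nonneg (J y)).eq_or_lt with h0 | h0
    · exact ⟨y, by simp, by simp [← h0]⟩
    obtain ⟨_, ⟨b, hb, rfl⟩, hd⟩ :=
      Metric.mem_closure_iff.1 (mem_closure_image_closedBall ι hι y) (‖J y‖ / 2) (by positivity)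
    refine ⟨y - b, by simpa using hb, ?_⟩
    rw [map_sub, ← dist_eq_norm]
    exact hd.le
  choose T hT1 hT2 using hstep
  -- the residuals `T^[n] x` have images of size at most `‖J x‖ / 2 ^ n`, and converge to `0`
  have hgeom : ∀ n, ‖J (T^[n] x)‖ ≤ ‖J x‖ / 2 ^ n := by
    intro n
    induction n with
    | zero => simp
    | succ n ih =>
      rw [Function.iterate_succ_apply']
      refine (hT2 _).trans ?_
      rw [pow_succ, ← div_div]
      gcongr
  have hdist : ∀ n, dist (T^[n] x) (T^[n + 1] x) ≤ 2 * ‖J x‖ / 2 / 2 ^ n := by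
    intro n
    rw [Function.iterate_succ_apply', dist_eq_norm, mul_div_cancel_left₀ _ two_ne_zero]
    exact (hT1 _).trans (hgeom n)
  obtain ⟨a, ha⟩ := cauchySeq_tendsto_of_complete (cauchySeq_of_le_geometric_two hdist)
  have hJa : J a = 0 := by
    refine tendsto_nhds_unique ((J.continuous.tendsto a).comp ha) ?_
    refine squeeze_zero_norm hgeom ?_
    simpa [div_eq_mul_inv] using
      (tendsto_pow_atTop_nhds_zero_of_lt_one (r := (2 : ℝ)⁻¹) (by norm_num)
        (by norm_num)).const_mul ‖J x‖
  have ha0 : a = 0 := hsep a fun v => DFunLike.congr_fun hJa v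
  have := dist_le_of_le_geometric_two_of_tendsto₀ hdist ha
  simpa [ha0] using this

section Regularity

open InnerProductSpace Laplacian Topology ContDiff Convolution

/-! ### A reproducing kernel for harmonic functions -/

section RadialKernel

variable {E : Type*} [NormedAddCommGroup E] [InnerProductSpace ℝ E] [FiniteDimensional ℝ E]
  [MeasurableSpace E] [BorelSpace E] {G : Type*} [NormedAddCommGroup G] [NormedSpace ℝ G]

/-- A smooth bump `ρ ≥ 0` of positive integral that vanishes off the ball of radius `R` and for
which `w ↦ ρ w • w` is minus the gradient of a second such bump `η`. Both are radial: with `S` the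
smooth transition function, `η w = S (1 - ‖w‖² / R²)`. Nontriviality of `E` is needed because
`ρ` vanishes at the origin. -/
theorem exists_radial_kernel [Nontrivial E] (μ : Measure E) [μ.IsAddHaarMeasure]
    {R : ℝ} (hR : 0 < R) :
    ∃ ρ η : E → ℝ, ContDiff ℝ ∞ ρ ∧ ContDiff ℝ ∞ η ∧ (∀ w, R < ‖w‖ → ρ w = 0) ∧
      (∀ w, R < ‖w‖ → η w = 0) ∧ (∀ w v, fderiv ℝ η w v = -(ρ w * inner ℝ w v)) ∧
      0 < ∫ w, ρ w ∂μ := by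
  set S := Real.smoothTransition
  have hS : ContDiff ℝ ∞ S := Real.smoothTransition.contDiff
  have hS' : ContDiff ℝ ∞ (deriv S) := ((contDiff_infty_iff_deriv).1 hS).2
  have hS'nn : ∀ s, 0 ≤ deriv S s := fun s => Real.smoothTransition.monotone.deriv_nonneg
  set q : E → ℝ := fun w => 1 - ‖w‖ ^ 2 / R ^ 2 with hq
  have hqc : ContDiff ℝ ∞ q := contDiff_const.sub ((contDiff_norm_sq ℝ).div_const _)
  have hqneg : ∀ w, R < ‖w‖ → q w < 0 := by
    intro w hw
    have : 1 < ‖w‖ ^ 2 / R ^ 2 := by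
      rw [one_lt_div (by positivity)]; gcongr
    simp only [hq]; linarith
  have hS'neg : ∀ s < 0, deriv S s = 0 := by
    intro s hs
    have : S =ᶠ[𝓝 s] fun _ => 0 := by
      filter_upwards [Iio_mem_nhds hs] with t ht
      exact Real.smoothTransition.zero_of_nonpos (le_of_lt ht)
    rw [this.deriv_eq]; simp
  have hρc : ContDiff ℝ ∞ fun w : E => 2 / R ^ 2 * deriv S (q w) :=
    contDiff_const.mul (hS'.comp hqc)
  have hρ0 : ∀ w : E, R < ‖w‖ → 2 / R ^ 2 * deriv S (q w) = 0 := by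
    intro w hw; rw [hS'neg _ (hqneg w hw), mul_zero]
  refine ⟨fun w => 2 / R ^ 2 * deriv S (q w), fun w => S (q w), hρc, hS.comp hqc, hρ0, ?_, ?_, ?_⟩
  · intro w hw
    exact Real.smoothTransition.zero_of_nonpos (hqneg w hw).le
  · intro w v
    have h1 : HasFDerivAt q (-((R ^ 2)⁻¹ • (2 • innerSL ℝ w))) w := by
      have := ((hasStrictFDerivAt_norm_sq w).hasFDerivAt.const_mul ((R ^ 2)⁻¹)).const_sub 1
      refine this.congr_of_eventuallyEq (.of_forall fun y => ?_)
      simp only [hq]; ring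
    have h2 : HasDerivAt S (deriv S (q w)) (q w) :=
      (hS.differentiable (by simp) _).hasDerivAt
    rw [HasFDerivAt.fderiv (f := fun w => S (q w)) (h2.comp_hasFDerivAt w h1)]
    simp
    ring
  · -- by the mean value theorem `S` has slope `1` at some `s ∈ (0, 1)`, which is a value of `q`
    obtain ⟨s, ⟨hs0, hs1⟩, hs⟩ := exists_deriv_eq_slope S zero_lt_one
      hS.continuous.continuousOn (hS.differentiable (by simp)).differentiableOn
    simp only [S, Real.smoothTransition.one, Real.smoothTransition.zero] at hs
    obtain ⟨w, hw⟩ := exists_norm_eq E (c := R * √(1 - s)) (by positivity)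
    refine hρc.continuous.integral_pos_of_hasCompactSupport_nonneg_nonzero
      (x := w) ?_ (fun w => mul_nonneg (by positivity) (hS'nn _)) ?_
    · refine HasCompactSupport.intro (isCompact_closedBall (0 : E) R) fun w hw => hρ0 w ?_
      simpa using hw
    · have : q w = s := by
        simp only [hq, hw, mul_pow, Real.sq_sqrt (show (0:ℝ) ≤ 1 - s by linarith)]
        field_simp; ring
      rw [this]
      simp only [S, hs]
      positivity

/-- The derivative of `t ↦ ∫ ρ w • H (z + t • w)` vanishes on `[0, 1]` when `H` is harmonic on the
ball of radius `R` about `z`: since `ρ w • w` is minus the gradient of `η`, integration by parts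
turns it into `t * ∫ η w • Δ H (z + t • w)`. -/
theorem integral_kernel_smul_fderiv_eq_zero (μ : Measure E) [μ.IsAddHaarMeasure] {R : ℝ}
    {ρ η : E → ℝ} (hρ : ContDiff ℝ ∞ ρ) (hη : ContDiff ℝ ∞ η) (hρ0 : ∀ w, R < ‖w‖ → ρ w = 0)
    (hη0 : ∀ w, R < ‖w‖ → η w = 0)
    (hρη : ∀ w v, fderiv ℝ η w v = -(ρ w * inner ℝ w v))
    {H : E → G} (hH : ContDiff ℝ 2 H) {z : E}
    (hΔ : ∀ y ∈ Metric.closedBall z R, Δ H y = 0) {t : ℝ} (ht0 : 0 ≤ t) (ht1 : t ≤ 1) :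
    ∫ w, ρ w • fderiv ℝ H (z + t • w) w ∂μ = 0 := by
  have hcρ : HasCompactSupport ρ :=
    HasCompactSupport.intro (isCompact_closedBall (0 : E) R) fun w hw => hρ0 w (by simpa using hw)
  have hcη : HasCompactSupport η :=
    HasCompactSupport.intro (isCompact_closedBall (0 : E) R) fun w hw => hη0 w (by simpa using hw)
  have hDH : ContDiff ℝ 1 (fderiv ℝ H) := hH.fderiv_right (by norm_num)
  set b := stdOrthonormalBasis ℝ E
  have hDi : ∀ i, ContDiff ℝ 1 fun w => fderiv ℝ H (z + t • w) (b i) := fun i =>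
    (hDH.comp (contDiff_const.add (contDiff_id.const_smul t))).clm_apply contDiff_const
  have hDDi : ∀ i w, fderiv ℝ (fun w => fderiv ℝ H (z + t • w) (b i)) w (b i) =
      t • fderiv ℝ (fderiv ℝ H) (z + t • w) (b i) (b i) := by
    intro i w
    have h1 : HasFDerivAt (fun w : E => z + t • w) (t • ContinuousLinearMap.id ℝ E) w :=
      ((hasFDerivAt_id w).const_smul t).const_add z
    have h2 := (hDH.differentiable (by norm_num) (z + t • w)).hasFDerivAt
    have h3 := (h2.comp w h1).clm_apply (hasFDerivAt_const (b i) w)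
    rw [HasFDerivAt.fderiv (f := fun w => fderiv ℝ H (z + t • w) (b i)) h3]
    simp
  have hcont : ∀ i, Continuous fun w => fderiv ℝ (fun w => fderiv ℝ H (z + t • w) (b i)) w (b i) :=
    fun i => ((hDi i).continuous_fderiv (by norm_num)).clm_apply continuous_const
  have hη' : Continuous (fderiv ℝ η) := hη.continuous_fderiv (by simp)
  have hparts : ∀ i, ∫ w, (ρ w * inner ℝ w (b i)) • fderiv ℝ H (z + t • w) (b i) ∂μ =
      ∫ w, η w • (t • fderiv ℝ (fderiv ℝ H) (z + t • w) (b i) (b i)) ∂μ := by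
    intro i
    have := integral_smul_fderiv_eq_neg_fderiv_smul_of_integrable (μ := μ) (f := η)
      (g := fun w => fderiv ℝ H (z + t • w) (b i)) (v := b i)
      (((hη'.clm_apply continuous_const).smul (hDi i).continuous).integrable_of_hasCompactSupport
        ((hcη.fderiv_apply ℝ (b i)).smul_right))
      ((hη.continuous.smul (hcont i)).integrable_of_hasCompactSupport hcη.smul_right)
      ((hη.continuous.smul (hDi i).continuous).integrable_of_hasCompactSupport hcη.smul_right)
      (fun x _ => hη.differentiable (by simp) x)
      (fun x _ => (hDi i).differentiable (by norm_num) x)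
    simp only [hDDi, hρη, neg_smul, integral_neg, neg_neg] at this
    exact this.symm
  have hexp : ∀ w, ρ w • fderiv ℝ H (z + t • w) w =
      ∑ i, (ρ w * inner ℝ w (b i)) • fderiv ℝ H (z + t • w) (b i) := by
    intro w
    conv_lhs => rw [← b.sum_repr w, map_sum, Finset.smul_sum]
    refine Finset.sum_congr rfl fun i _ => ?_
    rw [map_smul, smul_smul, b.repr_apply_apply, real_inner_comm, b.sum_repr]
  simp only [hexp]
  rw [integral_finsetSum]
  · simp only [hparts]
    rw [← integral_finsetSum]
    · refine integral_eq_zero_of_ae (.of_forall fun w => ?_)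
      by_cases hw : R < ‖w‖
      · simp [hη0 w hw]
      have hmem : z + t • w ∈ Metric.closedBall z R := by
        rw [Metric.mem_closedBall, dist_eq_norm, add_sub_cancel_left, norm_smul, Real.norm_eq_abs,
          abs_of_nonneg ht0]
        nlinarith [norm_nonneg w]
      have := hΔ _ hmem
      rw [laplacian_eq_iteratedFDeriv_orthonormalBasis H b] at this
      simp only [iteratedFDeriv_two_apply, Matrix.cons_val_zero, Matrix.cons_val_one] at this
      simp only [← Finset.smul_sum, this, smul_zero, Pi.zero_apply]
    · intro i _
      refine Continuous.integrable_of_hasCompactSupport ?_ hcη.smul_right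
      simp only [← hDDi]
      exact hη.continuous.smul (hcont i)
  · intro i _
    refine Continuous.integrable_of_hasCompactSupport ?_ hcρ.mul_right.smul_right
    exact (hρ.continuous.mul (by fun_prop)).smul (hDi i).continuous

/-- The mean value property with respect to the radial weight `ρ`, obtained by comparing the
dilations `t = 0` and `t = 1` of the kernel. -/
theorem integral_kernel_smul_add (μ : Measure E) [μ.IsAddHaarMeasure] {R : ℝ}
    {ρ η : E → ℝ} (hρ : ContDiff ℝ ∞ ρ) (hη : ContDiff ℝ ∞ η) (hρ0 : ∀ w, R < ‖w‖ → ρ w = 0)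
    (hη0 : ∀ w, R < ‖w‖ → η w = 0)
    (hρη : ∀ w v, fderiv ℝ η w v = -(ρ w * inner ℝ w v)) [CompleteSpace G]
    {H : E → G} (hH : ContDiff ℝ 2 H) (hHc : HasCompactSupport H) {z : E}
    (hΔ : ∀ y ∈ Metric.closedBall z R, Δ H y = 0) :
    ∫ w, ρ w • H (z + w) ∂μ = (∫ w, ρ w ∂μ) • H z := by
  have hcρ : HasCompactSupport ρ :=
    HasCompactSupport.intro (isCompact_closedBall (0 : E) R) fun w hw => hρ0 w (by simpa using hw)
  obtain ⟨C, hC⟩ := (hHc.fderiv ℝ).exists_bound_of_continuous (hH.continuous_fderiv (by norm_num))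
  have hder : ∀ t : ℝ, HasDerivAt (fun t : ℝ => ∫ w, ρ w • H (z + t • w) ∂μ)
      (∫ w, ρ w • fderiv ℝ H (z + t • w) w ∂μ) t := by
    intro t
    have hHcont := hH.continuous
    have hDcont := hH.continuous_fderiv (by norm_num)
    have hρcont := hρ.continuous
    refine (hasDerivAt_integral_of_dominated_loc_of_deriv_le (s := Set.univ)
      (F' := fun t w => ρ w • fderiv ℝ H (z + t • w) w)
      (bound := fun w => ‖ρ w‖ * (C * ‖w‖)) Filter.univ_mem ?_ ?_ ?_ ?_ ?_ ?_).2
    · exact .of_forall fun s =>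
        (by fun_prop : Continuous fun w => ρ w • H (z + s • w)).aestronglyMeasurable
    · exact (by fun_prop : Continuous fun w => ρ w • H (z + t • w)).integrable_of_hasCompactSupport
        hcρ.smul_right
    · exact (by fun_prop : Continuous fun w => ρ w • fderiv ℝ H (z + t • w) w).aestronglyMeasurable
    · refine .of_forall fun w s _ => ?_
      rw [norm_smul]
      gcongr
      exact ((fderiv ℝ H (z + s • w)).le_opNorm w).trans (by gcongr; exact hC _)
    · exact (by fun_prop : Continuous fun w => ‖ρ w‖ * (C * ‖w‖)).integrable_of_hasCompactSupport
        hcρ.norm.mul_right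
    · refine .of_forall fun w s _ => ?_
      have h1 : HasDerivAt (fun s : ℝ => z + s • w) w s := by
        simpa using ((hasDerivAt_id s).smul_const w).const_add z
      exact ((hH.differentiable (by norm_num) _).hasFDerivAt.comp_hasDerivAt s h1).const_smul (ρ w)
  have := constant_of_has_deriv_right_zero (a := 0) (b := 1)
    (fun t _ => (hder t).continuousAt.continuousWithinAt)
    (fun t ht => by
      have h := hder t
      rw [integral_kernel_smul_fderiv_eq_zero μ hρ hη hρ0 hη0 hρη hH hΔ ht.1 ht.2.le] at h
      exact h.hasDerivWithinAt) 1 (by simp)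
  simpa [integral_smul_const] using this

end RadialKernel

universe v

theorem exists_closedBall_four_mul_subset {E : Type*} [PseudoMetricSpace E] {Ω : Set E}
    (hΩ : IsOpen Ω) {x₀ : E} (hx₀ : x₀ ∈ Ω) : ∃ R > 0, Metric.closedBall x₀ (4 * R) ⊆ Ω := by
  obtain ⟨r, hr, h⟩ := Metric.nhds_basis_closedBall.mem_iff.1 (hΩ.mem_nhds hx₀)
  exact ⟨r / 4, by positivity, by rwa [mul_div_cancel₀ _ (four_ne_zero)]⟩

/-- Multiplication by a cutoff function turns a locally defined harmonic function into a globally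
`C²`, compactly supported one. -/
theorem exists_contDiff_hasCompactSupport_eqOn_ball {E G : Type*}
    [NormedAddCommGroup E] [InnerProductSpace ℝ E] [FiniteDimensional ℝ E]
    [NormedAddCommGroup G] [NormedSpace ℝ G] {Ω : Set E} {h : E → G}
    (hh : HarmonicOnNhd h Ω) {x₀ : E} {r r' : ℝ} (hr : 0 < r) (hrr' : r < r')
    (hΩ : Metric.closedBall x₀ r' ⊆ Ω) :
    ∃ H : E → G, ContDiff ℝ 2 H ∧ HasCompactSupport H ∧ Set.EqOn H h (Metric.ball x₀ r) := by
  let χ : ContDiffBump x₀ := ⟨r, r', hr, hrr'⟩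
  refine ⟨fun y => χ y • h y, contDiff_iff_contDiffAt.2 fun y => ?_,
    χ.hasCompactSupport.smul_right, fun y hy => ?_⟩
  · by_cases hy : y ∈ Metric.closedBall x₀ r'
    · exact χ.contDiffAt.smul (hh y (hΩ hy)).1
    · have : y ∉ tsupport χ := by rwa [χ.tsupport_eq]
      have h0 : (fun y => χ y • h y) =ᶠ[𝓝 y] fun _ => 0 := by
        filter_upwards [notMem_tsupport_iff_eventuallyEq.1 this] with w hw
        simp [hw]
      exact contDiffAt_const.congr_of_eventuallyEq h0
  · simp [χ.one_of_mem_closedBall (Metric.ball_subset_closedBall hy)]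

variable {E : Type*} [NormedAddCommGroup E] [InnerProductSpace ℝ E] [FiniteDimensional ℝ E]
  [MeasurableSpace E] [BorelSpace E]

/-- A kernel, depending only on `R`, that reproduces all harmonic functions: their values on the ball
of radius `R` are given by integration against translates of `ρ` over the ball of radius `2 * R`.
The factor `4` leaves room for a cutoff function. -/
theorem exists_reproducing_kernel (μ : Measure E) [μ.IsAddHaarMeasure] {R : ℝ} (hR : 0 < R) :
    ∃ ρ : E → ℝ, ContDiff ℝ ∞ ρ ∧ HasCompactSupport ρ ∧
      ∀ (G : Type v) [NormedAddCommGroup G] [NormedSpace ℝ G] [CompleteSpace G] (Ω : Set E)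
        (h : E → G), HarmonicOnNhd h Ω → ∀ x₀ : E, Metric.closedBall x₀ (4 * R) ⊆ Ω →
        ∀ z ∈ Metric.closedBall x₀ R,
          h z = ∫ y in Metric.closedBall x₀ (2 * R), ρ (z - y) • h y ∂μ := by
  rcases subsingleton_or_nontrivial E with hE | hE
  · -- on a one-point space every function is constant, and a constant kernel will do
    have : CompactSpace E := Finite.compactSpace
    refine ⟨fun _ => (μ.real Set.univ)⁻¹, contDiff_const, HasCompactSupport.of_compactSpace _, ?_⟩
    intro G _ _ _ Ω h _ x₀ _ z _
    have hK : Metric.closedBall x₀ (2 * R) = Set.univ :=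
      Set.eq_univ_of_forall fun y => by
        rw [Subsingleton.elim y x₀]; exact Metric.mem_closedBall_self (by positivity)
    have h0 : μ.real Set.univ ≠ 0 := by
      rw [measureReal_def, ENNReal.toReal_ne_zero]
      exact ⟨isOpen_univ.measure_ne_zero μ ⟨x₀, trivial⟩, measure_ne_top μ _⟩
    have hz : h = fun _ => h z := funext fun y => by rw [Subsingleton.elim y z]
    rw [hK, Measure.restrict_univ, hz]
    simp [smul_smul, h0]
  · obtain ⟨ρ, η, hρ, hη, hρ0, hη0, hρη, hpos⟩ := exists_radial_kernel μ hR
    set I := ∫ w, ρ w ∂μ with hI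
    have hcρ : HasCompactSupport fun w => I⁻¹ * ρ (-w) :=
      HasCompactSupport.intro (isCompact_closedBall (0 : E) R) fun w hw => by
        rw [hρ0 _ (by simpa using hw), mul_zero]
    refine ⟨fun w => I⁻¹ * ρ (-w), contDiff_const.mul (hρ.comp contDiff_neg), hcρ, ?_⟩
    intro G _ _ _ Ω h hh x₀ hΩ z hz
    obtain ⟨H, hH, hHc, hHh⟩ := exists_contDiff_hasCompactSupport_eqOn_ball hh
      (r := 3 * R) (r' := 4 * R) (by positivity) (by linarith) hΩ
    rw [Metric.mem_closedBall] at hz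
    have hsub : Metric.closedBall z R ⊆ Metric.closedBall x₀ (2 * R) :=
      Metric.closedBall_subset_closedBall' (by linarith)
    have hsub' : Metric.closedBall x₀ (2 * R) ⊆ Metric.ball x₀ (3 * R) :=
      Metric.closedBall_subset_ball (by linarith)
    have hΔ : ∀ y ∈ Metric.closedBall z R, Δ H y = 0 := by
      intro y hy
      have hy' := hsub' (hsub hy)
      have hHy : H =ᶠ[𝓝 y] h := by
        filter_upwards [Metric.isOpen_ball.mem_nhds hy'] with w hw using hHh hw
      rw [(laplacian_congr_nhds hHy).eq_of_nhds]
      refine (hh y (hΩ ?_)).2.eq_of_nhds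
      exact Metric.ball_subset_closedBall (Metric.ball_subset_ball (by linarith) hy')
    have key := integral_kernel_smul_add μ hρ hη hρ0 hη0 hρη hH hHc hΔ
    have hzz : z ∈ Metric.closedBall z R := Metric.mem_closedBall_self hR.le
    calc h z = H z := (hHh (hsub' (hsub hzz))).symm
      _ = I⁻¹ • ∫ w, ρ w • H (z + w) ∂μ := by
        rw [key, smul_smul, inv_mul_cancel₀ hpos.ne', one_smul]
      _ = I⁻¹ • ∫ y, ρ (y - z) • H y ∂μ := by
        rw [← integral_add_left_eq_self (fun y => ρ (y - z) • H y) z]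
        simp
      _ = I⁻¹ • ∫ y in Metric.closedBall x₀ (2 * R), ρ (y - z) • H y ∂μ := by
        rw [setIntegral_eq_integral_of_forall_compl_eq_zero]
        intro y hy
        have : y ∉ Metric.closedBall z R := fun h => hy (hsub h)
        rw [hρ0, zero_smul]
        simpa [dist_eq_norm] using this
      _ = I⁻¹ • ∫ y in Metric.closedBall x₀ (2 * R), ρ (y - z) • h y ∂μ := by
        congr 1
        refine setIntegral_congr_fun measurableSet_closedBall fun y hy => ?_
        simp only [hHh (hsub' hy)]
      _ = _ := by
        rw [← integral_smul]
        simp [mul_smul]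

/-! ### Continuous functions that are weakly harmonic or weakly holomorphic -/

/-- A continuous function whose compositions with a separating family of functionals are harmonic is
harmonic. The reproducing formula passes from the compositions to `u`, which makes `u` smooth, and
then the functionals commute with the Laplacian. -/
theorem harmonicOnNhd_of_continuousOn_of_forall_dual {F : Type*} [NormedAddCommGroup F]
    [NormedSpace ℝ F] [CompleteSpace F] {Ω : Set E} (hΩ : IsOpen Ω) {u : E → F}
    (hu : ContinuousOn u Ω) {I : Type*} (φ : I → StrongDual ℝ F)
    (hφ : ∀ x, (∀ i, φ i x = 0) → x = 0) (h : ∀ i, HarmonicOnNhd (fun z => φ i (u z)) Ω) :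
    HarmonicOnNhd u Ω := by
  let μ : Measure E := Measure.addHaar
  have hsmooth : ∀ x ∈ Ω, ContDiffAt ℝ 2 u x := by
    intro x₀ hx₀
    obtain ⟨R, hR, hRΩ⟩ := exists_closedBall_four_mul_subset hΩ hx₀
    obtain ⟨ρ, hρ, hρc, hrep⟩ := exists_reproducing_kernel.{0} μ hR
    set K := Metric.closedBall x₀ (2 * R)
    have hK : IsCompact K := isCompact_closedBall _ _
    have huK : ContinuousOn u K :=
      hu.mono ((Metric.closedBall_subset_closedBall (by linarith)).trans hRΩ)
    have hint : ∀ z, IntegrableOn (fun y => ρ (z - y) • u y) K μ := fun z =>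
      ((hρ.continuous.comp (continuous_const.sub continuous_id)).continuousOn.smul
        huK).integrableOn_compact hK
    have hueq : ∀ z ∈ Metric.closedBall x₀ R, u z = ∫ y in K, ρ (z - y) • u y ∂μ := by
      intro z hz
      refine sub_eq_zero.1 (hφ _ fun i => ?_)
      rw [map_sub, ← ContinuousLinearMap.integral_comp_comm _ (hint z),
        hrep ℝ Ω _ (h i) x₀ hRΩ z hz]
      simp only [map_smul, sub_self, K]
    have hconv : ∀ z, ∫ y in K, ρ (z - y) • u y ∂μ =
        (ρ ⋆[ContinuousLinearMap.lsmul ℝ ℝ, μ] K.indicator u) z := by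
      intro z
      rw [convolution_eq_swap, ← integral_indicator hK.measurableSet]
      congr 1 with y
      by_cases hy : y ∈ K <;> simp [hy]
    have hCD : ContDiff ℝ ∞ (ρ ⋆[ContinuousLinearMap.lsmul ℝ ℝ, μ] K.indicator u) :=
      hρc.contDiff_convolution_left _ hρ
        ((integrable_indicator_iff hK.measurableSet).2
          (huK.integrableOn_compact hK)).locallyIntegrable
    refine ((contDiff_infty.1 hCD 2).contDiffAt).congr_of_eventuallyEq ?_
    filter_upwards [Metric.closedBall_mem_nhds x₀ hR] with z hz
    rw [hueq z hz, hconv]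
  have hlap : ∀ x ∈ Ω, Δ u x = 0 := by
    intro x hx
    refine hφ _ fun i => ?_
    have h1 := (hsmooth x hx).laplacian_CLM_comp_left (l := φ i)
    have h2 := (h i x hx).2.eq_of_nhds
    exact h1.symm.trans h2
  intro x hx
  refine ⟨hsmooth x hx, ?_⟩
  filter_upwards [hΩ.mem_nhds hx] with y hy using hlap y hy

/-- A continuous function whose compositions with a separating family of functionals are holomorphic
satisfies Cauchy's integral formula, hence is holomorphic. -/
theorem differentiableOn_of_continuousOn_of_forall_dual {F : Type*} [NormedAddCommGroup F]
    [NormedSpace ℂ F] [CompleteSpace F] {Ω : Set ℂ} (hΩ : IsOpen Ω) {u : ℂ → F}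
    (hu : ContinuousOn u Ω) {I : Type*} (φ : I → StrongDual ℂ F)
    (hφ : ∀ x, (∀ i, φ i x = 0) → x = 0)
    (h : ∀ i, DifferentiableOn ℂ (fun z => φ i (u z)) Ω) : DifferentiableOn ℂ u Ω := by
  intro c hc
  obtain ⟨r, hr, hrΩ⟩ := Metric.nhds_basis_closedBall.mem_iff.1 (hΩ.mem_nhds hc)
  have hcirc : ContinuousOn u (Metric.sphere c r) :=
    hu.mono (Metric.sphere_subset_closedBall.trans hrΩ)
  lift r to NNReal using hr.le
  have hps := hasFPowerSeriesOn_cauchy_integral (hcirc.circleIntegrable r.2)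
    (NNReal.coe_pos.1 hr)
  refine DifferentiableAt.differentiableWithinAt ?_
  refine (hps.analyticAt.differentiableAt).congr_of_eventuallyEq ?_
  filter_upwards [Metric.ball_mem_nhds c hr] with w hw
  refine sub_eq_zero.1 (hφ _ fun i => ?_)
  have hne : ∀ θ : ℝ, circleMap c r θ - w ≠ 0 := fun θ =>
    sub_ne_zero.2 (circleMap_ne_mem_ball hw θ)
  have hcont : Continuous fun θ : ℝ =>
      deriv (circleMap c r) θ • ((circleMap c r θ - w)⁻¹ • u (circleMap c r θ)) := by
    refine Continuous.smul ?_ (Continuous.smul ?_ ?_)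
    · exact (funext (deriv_circleMap c r) : deriv (circleMap c r) = _) ▸
        (by fun_prop : Continuous fun θ : ℝ => circleMap 0 r θ * Complex.I)
    · exact ((continuous_circleMap c r).sub continuous_const).inv₀ hne
    · exact hcirc.comp_continuous (continuous_circleMap c r)
        fun θ => circleMap_mem_sphere c hr.le θ
  have hcomm : φ i (∮ z in C(c, r), (z - w)⁻¹ • u z) = ∮ z in C(c, r), (z - w)⁻¹ • φ i (u z) := by
    rw [circleIntegral, circleIntegral,
      ← ContinuousLinearMap.intervalIntegral_comp_comm _ (hcont.intervalIntegrable _ _)]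
    simp only [map_smul]
  rw [map_sub, map_smul, hcomm,
    DifferentiableOn.circleIntegral_sub_inv_smul ((h i).mono hrΩ) hw, smul_smul,
    inv_mul_cancel₀ Complex.two_pi_I_ne_zero, one_smul, sub_self]

/-! ### Norm continuity from local `L¹`-bounds -/

/-- Harmonic functions bounded almost everywhere by `c * g`, for a fixed locally integrable `g`, are
locally Lipschitz with a constant proportional to `c` and otherwise independent of the function. -/
theorem exists_norm_sub_le_of_ae_norm_le {μ : Measure E} [μ.IsAddHaarMeasure] {Ω : Set E}
    (hΩ : IsOpen Ω) {g : E → ℝ} (hg : LocallyIntegrableOn g Ω μ) {x₀ : E} (hx₀ : x₀ ∈ Ω) :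
    ∃ C ≥ 0, ∃ R > 0, ∀ (G : Type v) [NormedAddCommGroup G] [NormedSpace ℝ G] [CompleteSpace G]
      (h : E → G) (c : ℝ), 0 ≤ c → HarmonicOnNhd h Ω → (∀ᵐ ξ ∂(μ.restrict Ω), ‖h ξ‖ ≤ c * g ξ) →
      ∀ z ∈ Metric.closedBall x₀ R, ‖h z - h x₀‖ ≤ C * c * ‖z - x₀‖ := by
  obtain ⟨R, hR, hRΩ⟩ := exists_closedBall_four_mul_subset hΩ hx₀
  obtain ⟨ρ, hρ, hρc, hrep⟩ := exists_reproducing_kernel.{v} μ hR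
  obtain ⟨L, hL⟩ := (contDiff_infty.1 hρ 1).lipschitzWith_of_hasCompactSupport hρc (by simp)
  set K := Metric.closedBall x₀ (2 * R)
  have hK : IsCompact K := isCompact_closedBall _ _
  have hKΩ : K ⊆ Ω := (Metric.closedBall_subset_closedBall (by linarith)).trans hRΩ
  have hgK : IntegrableOn g K μ := hg.integrableOn_compact_subset hKΩ hK
  refine ⟨L * |∫ y in K, g y ∂μ|, by positivity, R, hR, fun G _ _ _ h c hc hh hb z hz => ?_⟩
  have hint : ∀ w, IntegrableOn (fun y => ρ (w - y) • h y) K μ := fun w =>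
    ((hρ.continuous.comp (continuous_const.sub continuous_id)).continuousOn.smul
      (hh.continuousOn.mono hKΩ)).integrableOn_compact hK
  rw [hrep G Ω h hh x₀ hRΩ z hz, hrep G Ω h hh x₀ hRΩ x₀ (Metric.mem_closedBall_self hR.le),
    ← integral_sub (hint z) (hint x₀)]
  have hbK : ∀ᵐ y ∂(μ.restrict K), ‖h y‖ ≤ c * g y :=
    ae_restrict_of_ae_restrict_of_subset hKΩ hb
  have hle : ‖∫ y in K, (ρ (z - y) • h y - ρ (x₀ - y) • h y) ∂μ‖ ≤
      ∫ y in K, L * ‖z - x₀‖ * (c * g y) ∂μ := by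
    refine norm_integral_le_of_norm_le ((hgK.const_mul c).const_mul _) ?_
    filter_upwards [hbK] with y hy
    rw [← sub_smul, norm_smul]
    gcongr
    have := hL.dist_le_mul (z - y) (x₀ - y)
    rwa [dist_sub_right, dist_eq_norm, dist_eq_norm] at this
  refine hle.trans ?_
  rw [integral_const_mul, integral_const_mul]
  calc L * ‖z - x₀‖ * (c * ∫ y in K, g y ∂μ) ≤ L * ‖z - x₀‖ * (c * |∫ y in K, g y ∂μ|) := by
        gcongr
        exact le_abs_self _
    _ = _ := by ring

/-- If `φ ∘ f` is harmonic for all `φ ∈ V` and `f` is locally `L¹`-bounded, then `J ∘ f` is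
continuous for the norm of the dual of `V`: the functions `φ ∘ f` with `‖φ‖ ≤ 1` are locally
equi-Lipschitz. -/
theorem continuousOn_flip_comp {𝕜 X V : Type*} [RCLike 𝕜] [NormedAddCommGroup X]
    [NormedSpace 𝕜 X] [NormedAddCommGroup V] [NormedSpace 𝕜 V] (ι : V →ₗᵢ[𝕜] StrongDual 𝕜 X)
    {μ : Measure E} [μ.IsAddHaarMeasure] {Ω : Set E} (hΩ : IsOpen Ω) {f : E → X} {g : E → ℝ}
    (hg : LocallyIntegrableOn g Ω μ) (hfg : ∀ᵐ ξ ∂(μ.restrict Ω), ‖f ξ‖ ≤ g ξ)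
    (h : ∀ v, HarmonicOnNhd (fun z => ι v (f z)) Ω) :
    ContinuousOn (fun z => ι.toContinuousLinearMap.flip (f z)) Ω := by
  intro x₀ hx₀
  obtain ⟨C, hC, R, hR, hlip⟩ := exists_norm_sub_le_of_ae_norm_le hΩ hg hx₀
  refine ContinuousAt.continuousWithinAt (continuousAt_of_locally_lipschitz hR C fun z hz => ?_)
  rw [dist_eq_norm, dist_eq_norm, ← map_sub]
  refine ContinuousLinearMap.opNorm_le_bound _ (by positivity) fun v => ?_
  have := hlip 𝕜 _ ‖v‖ (norm_nonneg v) (h v) (by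
    filter_upwards [hfg] with ξ hξ
    refine ((ι v).le_opNorm _).trans ?_
    rw [ι.norm_map]
    gcongr) z (Metric.mem_closedBall.2 hz.le)
  calc ‖ι.toContinuousLinearMap.flip (f z - f x₀) v‖ = ‖ι v (f z) - ι v (f x₀)‖ := by
        rw [← map_sub]; rfl
    _ ≤ C * ‖v‖ * ‖z - x₀‖ := this
    _ = C * ‖z - x₀‖ * ‖v‖ := by ring

theorem continuousOn_of_continuousOn_flip_comp {𝕜 X V : Type*} [RCLike 𝕜] [NormedAddCommGroup X]
    [NormedSpace 𝕜 X] [CompleteSpace X] [NormedAddCommGroup V] [NormedSpace 𝕜 V]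
    (ι : V →ₗᵢ[𝕜] StrongDual 𝕜 X) (hsep : ∀ x : X, (∀ v, ι v x = 0) → x = 0)
    (hι : ∀ Λ : StrongDual 𝕜 (StrongDual 𝕜 V),
      Λ.comp ι.toContinuousLinearMap.flip ∈ Set.range ι) {T : Type*} [TopologicalSpace T]
    {Ω : Set T} {f : T → X}
    (hf : ContinuousOn (fun z => ι.toContinuousLinearMap.flip (f z)) Ω) : ContinuousOn f Ω := by
  have hanti : AntilipschitzWith 2 ι.toContinuousLinearMap.flip :=
    AddMonoidHomClass.antilipschitz_of_bound _ fun x => norm_le_two_mul_norm_flip ι hsep hι x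
  exact (hanti.isInducing ι.toContinuousLinearMap.flip.continuous).continuousOn_iff.2 hf

/-! ### The space of all functionals giving a regular composition -/

/-- The harmonic case, with the space of all functionals `φ` for which `φ ∘ f` is harmonic presented
as the range of a linear isometry `ι`. -/
theorem harmonicOnNhd_of_range_eq {X V : Type*} [NormedAddCommGroup X] [NormedSpace ℝ X]
    [CompleteSpace X] [NormedAddCommGroup V] [NormedSpace ℝ V] (ι : V →ₗᵢ[ℝ] StrongDual ℝ X)
    (hsep : ∀ x : X, (∀ v, ι v x = 0) → x = 0)
    {μ : Measure E} [μ.IsAddHaarMeasure] {Ω : Set E} (hΩ : IsOpen Ω) {f : E → X} {g : E → ℝ}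
    (hg : LocallyIntegrableOn g Ω μ) (hfg : ∀ᵐ ξ ∂(μ.restrict Ω), ‖f ξ‖ ≤ g ξ)
    (hι : Set.range ι = {φ | HarmonicOnNhd (fun z => φ (f z)) Ω}) : HarmonicOnNhd f Ω := by
  have h : ∀ v, HarmonicOnNhd (fun z => ι v (f z)) Ω := fun v =>
    hι.subset (Set.mem_range_self v)
  have hu := continuousOn_flip_comp ι hΩ hg hfg h
  have hu' := harmonicOnNhd_of_continuousOn_of_forall_dual hΩ hu
    (fun v => ContinuousLinearMap.apply ℝ ℝ v) (fun _ h => ContinuousLinearMap.ext h) h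
  have hf : ContinuousOn f Ω := continuousOn_of_continuousOn_flip_comp ι hsep
    (fun Λ => hι.superset (hu'.comp_CLM Λ)) hu
  exact harmonicOnNhd_of_continuousOn_of_forall_dual hΩ hf ι hsep h

/-- The holomorphic case, with the space of all functionals `φ` for which `φ ∘ f` is holomorphic
presented as the range of a linear isometry `ι`. -/
theorem differentiableOn_of_range_eq {X V : Type*} [NormedAddCommGroup X] [NormedSpace ℂ X]
    [CompleteSpace X] [NormedAddCommGroup V] [NormedSpace ℂ V] (ι : V →ₗᵢ[ℂ] StrongDual ℂ X)
    (hsep : ∀ x : X, (∀ v, ι v x = 0) → x = 0)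
    {Ω : Set ℂ} (hΩ : IsOpen Ω) {f : ℂ → X} {g : ℂ → ℝ}
    (hg : LocallyIntegrableOn g Ω volume) (hfg : ∀ᵐ ξ ∂(volume.restrict Ω), ‖f ξ‖ ≤ g ξ)
    (hι : Set.range ι = {φ | DifferentiableOn ℂ (fun z => φ (f z)) Ω}) :
    DifferentiableOn ℂ f Ω := by
  have h : ∀ v, DifferentiableOn ℂ (fun z => ι v (f z)) Ω := fun v =>
    hι.subset (Set.mem_range_self v)
  have hu := continuousOn_flip_comp ι hΩ hg hfg fun v z hz =>
    ((h v).analyticAt (hΩ.mem_nhds hz)).harmonicAt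
  have hu' := differentiableOn_of_continuousOn_of_forall_dual hΩ hu
    (fun v => ContinuousLinearMap.apply ℂ ℂ v) (fun _ h => ContinuousLinearMap.ext h) h
  have hf : ContinuousOn f Ω := continuousOn_of_continuousOn_flip_comp ι hsep
    (fun Λ => hι.superset (Λ.differentiable.comp_differentiableOn hu')) hu
  exact differentiableOn_of_continuousOn_of_forall_dual hΩ hf ι hsep h

theorem harmonicOnNhd_of_veryWeaklyHarmonic {E X : Type*} [NormedAddCommGroup E]
    [InnerProductSpace ℝ E] [FiniteDimensional ℝ E] [MeasurableSpace E] [BorelSpace E]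
    [NormedAddCommGroup X] [NormedSpace ℝ X] [CompleteSpace X]
    {μ : Measure E} [μ.IsAddHaarMeasure] {Ω : Set E} (hΩ : IsOpen Ω)
    {f : E → X} {g : E → ℝ} (hg : LocallyIntegrableOn g Ω μ)
    (hfg : ∀ᵐ ξ ∂(μ.restrict Ω), ‖f ξ‖ ≤ g ξ) {W : Set (StrongDual ℝ X)}
    (hW : ∀ x : X, (∀ φ ∈ W, φ x = 0) → x = 0)
    (hfW : ∀ φ ∈ W, HarmonicOnNhd (fun z => φ (f z)) Ω) : HarmonicOnNhd f Ω := by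
  let V : Submodule ℝ (StrongDual ℝ X) :=
    { carrier := {φ | HarmonicOnNhd (fun z => φ (f z)) Ω}
      zero_mem' := by simp
      add_mem' := fun h₁ h₂ => h₁.add h₂
      smul_mem' := fun c _ h => HarmonicOnNhd.const_smul (c := c) h }
  exact harmonicOnNhd_of_range_eq (V := V) V.subtypeₗᵢ
    (fun x hx => hW x fun φ hφ => hx (⟨φ, hfW φ hφ⟩ : V))
    hΩ hg hfg Subtype.range_coe

theorem differentiableOn_of_veryWeaklyHolomorphic {X : Type*} [NormedAddCommGroup X]
    [NormedSpace ℂ X] [CompleteSpace X] {Ω : Set ℂ} (hΩ : IsOpen Ω)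
    {f : ℂ → X} {g : ℂ → ℝ} (hg : LocallyIntegrableOn g Ω volume)
    (hfg : ∀ᵐ ξ ∂(volume.restrict Ω), ‖f ξ‖ ≤ g ξ) {W : Set (StrongDual ℂ X)}
    (hW : ∀ x : X, (∀ φ ∈ W, φ x = 0) → x = 0)
    (hfW : ∀ φ ∈ W, DifferentiableOn ℂ (fun z => φ (f z)) Ω) : DifferentiableOn ℂ f Ω := by
  let V : Submodule ℂ (StrongDual ℂ X) :=
    { carrier := {φ | DifferentiableOn ℂ (fun z => φ (f z)) Ω}
      zero_mem' := by simp
      add_mem' := fun h₁ h₂ => h₁.add h₂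
      smul_mem' := fun c _ h => DifferentiableOn.const_smul h c }
  exact differentiableOn_of_range_eq (V := V) V.subtypeₗᵢ
    (fun x hx => hW x fun φ hφ => hx (⟨φ, hfW φ hφ⟩ : V))
    hΩ hg hfg Subtype.range_coe

end Regularity

/-! ### The characterization -/

theorem IsSeparating.eq_zero {𝕜 X : Type*} [RCLike 𝕜] [NormedAddCommGroup X] [NormedSpace 𝕜 X]
    {W : Set (StrongDual 𝕜 X)} (hW : IsSeparating W) (x : X) (hx : ∀ φ ∈ W, φ x = 0) : x = 0 := by
  by_contra h
  obtain ⟨φ, hφ, hne⟩ := hW x 0 h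
  exact hne (by rw [hx φ hφ, map_zero])

theorem isSeparating_univ {𝕜 X : Type*} [RCLike 𝕜] [NormedAddCommGroup X] [NormedSpace 𝕜 X] :
    IsSeparating (Set.univ : Set (StrongDual 𝕜 X)) := fun _ _ hxy => by
  by_contra! h
  exact hxy (SeparatingDual.eq_iff_forall_dual_eq.2 fun φ => h φ trivial)

theorem ContinuousOn.isLocallyL1Bounded {E X : Type*} [TopologicalSpace E]
    [SecondCountableTopology E] [MeasureSpace E] [OpensMeasurableSpace E]
    [IsLocallyFiniteMeasure (volume : Measure E)] [NormedAddCommGroup X] {Ω : Set E}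
    (hΩ : IsOpen Ω) {f : E → X} (hf : ContinuousOn f Ω) : IsLocallyL1Bounded Ω f :=
  ⟨fun ξ => ‖f ξ‖, hf.norm.locallyIntegrableOn hΩ.measurableSet, .of_forall fun _ => le_rfl⟩

theorem theorem1p1
    {X : Type*} [NormedAddCommGroup X] [NormedSpace ℂ X] [CompleteSpace X]
    {Y : Type*} [NormedAddCommGroup Y] [NormedSpace ℝ Y] [CompleteSpace Y] (d : ℕ) :
    (∀ Ω : Set ℂ, IsOpen Ω → ∀ f : ℂ → X,
      (DifferentiableOn ℂ f Ω ↔ IsLocallyL1Bounded Ω f ∧ IsVeryWeaklyHolomorphic Ω f)) ∧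
    (∀ Ω : Set (EuclideanSpace ℝ (Fin d)), IsOpen Ω → ∀ f : EuclideanSpace ℝ (Fin d) → Y,
      (InnerProductSpace.HarmonicOnNhd f Ω ↔
        IsLocallyL1Bounded Ω f ∧ IsVeryWeaklyHarmonic Ω f)) := by
  refine ⟨fun Ω hΩ f => ⟨fun hf => ⟨hf.continuousOn.isLocallyL1Bounded hΩ, Set.univ,
    isSeparating_univ, fun φ _ => φ.differentiable.comp_differentiableOn hf⟩, ?_⟩,
    fun Ω hΩ f => ⟨fun hf => ⟨hf.continuousOn.isLocallyL1Bounded hΩ, Set.univ,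
    isSeparating_univ, fun φ _ => hf.comp_CLM φ⟩, ?_⟩⟩
  · rintro ⟨⟨g, hg, hfg⟩, W, hW, hfW⟩
    exact differentiableOn_of_veryWeaklyHolomorphic hΩ hg hfg hW.eq_zero hfW
  · rintro ⟨⟨g, hg, hfg⟩, W, hW, hfW⟩
    exact harmonicOnNhd_of_veryWeaklyHarmonic hΩ hg hfg hW.eq_zero hfW
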